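/- Let $n\ge 2$ and let $\alpha_1,\dots,\alpha_n$ be i.i.d. random angles, uniformly distributed on $[0,2\pi)$ (points on the circle), with order statistics $\alpha_{(1)}\le\cdots\le\alpha_{(n)}$. Put $T_i=\alpha_{(i+1)}-\alpha_{(i)}$ for $1\le i\le n-1$ and $T_n=\alpha_{(1)}-\alpha_{(n)}+2\pi$, and let $$U_n=\frac12\sum_{i=1}^n\left|T_i-\frac{2\pi}{n}\right|$$ be Rao's spacing statistic. There exist integers $a_j^{(r)}$ ($1\le j\le r$) satisfying $$a_r^{(r)}=1\quad(r\ge1),\qquad a_1^{(r+1)}=(r+1)\,a_1^{(r)}\quad(r\ge1),\qquad a_j^{(r+1)}=(r+j)\,a_j^{(r)}+a_{j-1}^{(r)}\quad(2\le j\le r),$$ and for any such integers and every $r\ge1$ the $r$-th raw moment of $U_n$ is finite and equals $$E(U_n^r)=\frac{(2\pi)^r}{n^{\,n+r-1}\,(n)^{(r)}}\sum_{j=1}^r a_j^{(r)}\,(n)_j\,(n-j)^{\,n+r-1},$$ where $(n)^{(r)}=n(n+1)\cdots(n+r-1)$ and $(n)_j=n(n-1)\cdots(n-j+1)$. In particular,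 $E(U_n)=2\pi\left(1-\frac1n\right)^n$. -/

import Mathlib

open MeasureTheory ProbabilityTheory

/-- The order statistics of `n` reals: `orderStat x 0 ≤ ⋯ ≤ orderStat x (n - 1)` is the
nondecreasing rearrangement of `x`. -/
noncomputable def orderStat {n : ℕ} (x : Fin n → ℝ) (i : Fin n) : ℝ :=
  x (Tuple.sort x i)

/-- The `n` spacings on the circle of circumference `2π` of `n` angles in `[0, 2π)`: the gaps
between consecutive order statistics and, for the last index, the gap from the largest angle
around to the smallest one. -/
noncomputable def spacing {n : ℕ} (x : Fin n → ℝ) (i : Fin n) : ℝ :=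
  if h : (i : ℕ) + 1 < n then orderStat x ⟨i + 1, h⟩ - orderStat x i
  else orderStat x ⟨0, i.pos⟩ - orderStat x i + 2 * Real.pi

/-- Rao's spacing statistic of `n` angles in `[0, 2π)`. -/
noncomputable def raoSpacing {n : ℕ} (x : Fin n → ℝ) : ℝ :=
  1 / 2 * ∑ i : Fin n, |spacing x i - 2 * Real.pi / n|

/-- The family `a r j` (only the values with `1 ≤ j ≤ r` matter) satisfies the defining relations
of the moment coefficients. -/
structure IsRaoCoeff (a : ℕ → ℕ → ℤ) : Prop where
  diag : ∀ r : ℕ, 1 ≤ r → a r r = 1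
  first : ∀ r : ℕ, 1 ≤ r → a (r + 1) 1 = (r + 1) * a r 1
  step : ∀ r j : ℕ, 2 ≤ j → j ≤ r → a (r + 1) j = (r + j) * a r j + a r (j - 1)

/-! Since `|t - c| = 2 * max (t - c) 0 - (t - c)` and the spacings average to `c = 2π/n`, Rao's
statistic is the total excess of the spacings over `c`. Exchangeability reduces its moments to an
integral over increasing tuples, and rotating by the smallest angle reduces that to `n - 1` ordered
points in `[0, L]`, `L = 2π`, weighted by the last gap (`lintegral_circleExcess`). By symmetry of
the gaps that weight may be replaced by `L / n` (`mul_lintegral_weighted_gapSum`).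

The unweighted integral is an `n`-fold convolution, because divided powers of a sum split as in
`dividedPow_add`. With `z` marking the power, one gap has Laplace transform `s⁻¹ (1 + e^{-cs} ∑_{k ≥
1} (z/s)^k)`. The coefficient of `z^k` in its `n`-th power is `∑ j, C(n,j) * compNum k j * e^{-jcs}
/ s^(n+k)`, the transform of `excessIntegral`. The proof performs this computation by convolving
truncated powers, one gap at a time (`lintegral_gapSum`).

At `c = L / n` every `L - j c` with `j ≤ n` is nonnegative, so the truncations disappear. The
recursion forces `a r j = (r! / j!) * C(r-1, j-1)`, the Lah numbers (`IsRaoCoeff.mul_factorial`),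
which identifies the two sums. -/

open scoped ENNReal Nat
open Finset.HasAntidiagonal (antidiagonal)

/-! ### Truncated powers and their convolution -/

/-- The truncated divided power `x ^ p / p!` on `[0, ∞)`, extended by zero. -/
noncomputable def truncPow (p : ℕ) (x : ℝ) : ℝ≥0∞ :=
  if 0 ≤ x then ENNReal.ofReal (x ^ p / p !) else 0

theorem truncPow_of_nonneg {p : ℕ} {x : ℝ} (hx : 0 ≤ x) :
    truncPow p x = ENNReal.ofReal (x ^ p / p !) := if_pos hx

theorem truncPow_of_neg {p : ℕ} {x : ℝ} (hx : x < 0) : truncPow p x = 0 := if_neg hx.not_ge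

theorem measurable_truncPow (p : ℕ) : Measurable (truncPow p) :=
  Measurable.ite measurableSet_Ici (by fun_prop) measurable_const

theorem measurable_truncPow_sub (p : ℕ) (a : ℝ) : Measurable fun t => truncPow p (t - a) :=
  (measurable_truncPow p).comp (by fun_prop)

theorem measurable_truncPow_sub_sub (p : ℕ) (l b : ℝ) :
    Measurable fun t => truncPow p (l - t - b) :=
  (measurable_truncPow p).comp (by fun_prop)

theorem mul_truncPow {p : ℕ} {x : ℝ} (hx : 0 ≤ x) :
    ENNReal.ofReal x * truncPow p x = (p + 1) * truncPow (p + 1) x := by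
  rw [truncPow_of_nonneg hx, truncPow_of_nonneg hx, ← ENNReal.ofReal_mul hx]
  have : ((p : ℝ≥0∞) + 1) = ENNReal.ofReal ((p : ℝ) + 1) := by
    rw [ENNReal.ofReal_add (by positivity) zero_le_one]; simp
  rw [this, ← ENNReal.ofReal_mul (by positivity)]
  congr 1
  rw [Nat.factorial_succ, pow_succ]
  push_cast
  field_simp

theorem ofReal_add_mul_truncPow {p : ℕ} {x d : ℝ} (hd : 0 ≤ d) :
    ENNReal.ofReal (x + d) * truncPow p x =
      (p + 1) * truncPow (p + 1) x + ENNReal.ofReal d * truncPow p x := by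
  rcases lt_or_ge x 0 with hx | hx
  · simp [truncPow_of_neg hx]
  · rw [ENNReal.ofReal_add hx hd, add_mul, mul_truncPow hx]

theorem hasDerivAt_pow_succ_div_factorial (p : ℕ) (t : ℝ) :
    HasDerivAt (fun t : ℝ => t ^ (p + 1) / (p + 1)!) (t ^ p / p !) t := by
  refine ((hasDerivAt_pow (p + 1) t).div_const ((p + 1)! : ℝ)).congr_deriv ?_
  rw [Nat.factorial_succ]
  push_cast
  field_simp

theorem integral_pow_mul_sub_pow (p i : ℕ) (d : ℝ) :
    ∫ t in (0 : ℝ)..d, t ^ i / i ! * ((d - t) ^ p / p !) = d ^ (i + p + 1) / (i + p + 1)! := by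
  induction p generalizing i with
  | zero =>
    have := intervalIntegral.integral_eq_sub_of_hasDerivAt (a := 0) (b := d)
      (fun t _ => hasDerivAt_pow_succ_div_factorial i t)
      (by apply Continuous.intervalIntegrable; fun_prop)
    simpa using this
  | succ p ih =>
    have hv : ∀ t ∈ Set.uIcc 0 d, HasDerivAt (fun t : ℝ => (d - t) ^ (p + 1) / (p + 1)!)
        (-((d - t) ^ p / p !)) t := fun t _ => by
      have := (hasDerivAt_pow_succ_div_factorial p (d - t)).comp t ((hasDerivAt_id t).const_sub d)
      simpa [Function.comp_def] using this
    have := intervalIntegral.integral_deriv_mul_eq_sub (a := 0) (b := d)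
      (fun t _ => hasDerivAt_pow_succ_div_factorial i t) hv
      (by apply Continuous.intervalIntegrable; fun_prop)
      (by apply Continuous.intervalIntegrable; fun_prop)
    rw [intervalIntegral.integral_add (by apply Continuous.intervalIntegrable; fun_prop)
      (by apply Continuous.intervalIntegrable; fun_prop)] at this
    simp only [mul_neg, intervalIntegral.integral_neg, ih] at this
    simp at this
    rw [show i + (p + 1) + 1 = i + 1 + p + 1 by ring]
    linarith

/-- Convolution adds shifts and adds degrees plus one: after a translation it is the Beta integral
on `[0, d]`, and for `d < 0` the supports do not meet. -/
theorem lintegral_truncPow_mul (i p : ℕ) (a b l : ℝ) :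
    ∫⁻ t, truncPow i (t - a) * truncPow p (l - t - b) = truncPow (i + p + 1) (l - a - b) := by
  have h1 := lintegral_sub_right_eq_self (μ := (volume : Measure ℝ))
    (fun t => truncPow i t * truncPow p (l - a - b - t)) a
  simp only [show ∀ t, l - a - b - (t - a) = l - t - b by intro t; ring] at h1
  rw [h1]
  generalize l - a - b = d
  rcases lt_or_ge d 0 with hd | hd
  · rw [truncPow_of_neg hd]
    have : ∀ t, truncPow i t * truncPow p (d - t) = 0 := fun t => by
      rcases lt_or_ge t 0 with ht | ht
      · simp [truncPow_of_neg ht]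
      · rw [truncPow_of_neg (x := d - t) (by linarith), mul_zero]
    simp [this]
  · have : (fun t => truncPow i t * truncPow p (d - t)) = (Set.Icc 0 d).indicator
        fun t => ENNReal.ofReal (t ^ i / i ! * ((d - t) ^ p / p !)) := by
      funext t
      by_cases ht : t ∈ Set.Icc 0 d
      · rw [Set.indicator_of_mem ht, truncPow_of_nonneg ht.1,
          truncPow_of_nonneg (sub_nonneg.2 ht.2), ENNReal.ofReal_mul]
        have := ht.1
        positivity
      · rw [Set.indicator_of_notMem ht]
        rcases lt_or_ge t 0 with h | h
        · simp [truncPow_of_neg h]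
        · rw [truncPow_of_neg (x := d - t), mul_zero]
          by_contra h2
          exact ht ⟨h, by linarith⟩
    rw [this, lintegral_indicator measurableSet_Icc, ← ofReal_integral_eq_lintegral_ofReal,
      integral_Icc_eq_integral_Ioc, ← intervalIntegral.integral_of_le hd,
      integral_pow_mul_sub_pow, truncPow_of_nonneg hd]
    · apply Continuous.integrableOn_Icc
      fun_prop
    · refine (ae_restrict_iff' measurableSet_Icc).2 (.of_forall fun t ht => ?_)
      have h1 := ht.1
      have h2 := sub_nonneg.2 ht.2
      show 0 ≤ _
      positivity

/-! ### Counting compositions -/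

/-- The number of compositions of `k` into `j` positive parts. -/
def compNum : ℕ → ℕ → ℕ
  | 0, 0 => 1
  | 0, _ + 1 => 0
  | _ + 1, 0 => 0
  | k + 1, j + 1 => k.choose j

@[simp] theorem compNum_zero_zero : compNum 0 0 = 1 := rfl
@[simp] theorem compNum_zero_succ (j : ℕ) : compNum 0 (j + 1) = 0 := rfl
@[simp] theorem compNum_succ_zero (k : ℕ) : compNum (k + 1) 0 = 0 := rfl
@[simp] theorem compNum_succ_succ (k j : ℕ) : compNum (k + 1) (j + 1) = k.choose j := rfl
@[simp] theorem compNum_zero_one : compNum 0 1 = 0 := rfl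
@[simp] theorem compNum_succ_one (k : ℕ) : compNum (k + 1) 1 = 1 := Nat.choose_zero_right k

/-- Split a composition of `k + 1` by its first part `p.1 + 1`. -/
theorem sum_compNum (k j : ℕ) :
    ∑ p ∈ antidiagonal k, compNum p.2 j = compNum (k + 1) (j + 1) := by
  rw [Finset.Nat.sum_antidiagonal_eq_sum_range_succ (fun _ b => compNum b j)]
  refine (Finset.sum_range_reflect (fun b => compNum b j) (k + 1)).trans ?_
  induction k with
  | zero => cases j <;> simp
  | succ k ih =>
    rw [Finset.sum_range_succ, ih]
    cases j with
    | zero => simp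
    | succ j => simp only [compNum_succ_succ]; rw [Nat.choose_succ_succ k j]; ring

/-- By symmetry of the parts, `j + 1` times the sum of all first parts is the sum of all parts, and
each composition contributes `k + 1`. -/
theorem sum_mul_compNum (k j : ℕ) :
    (j + 1) * ∑ p ∈ antidiagonal k, (p.1 + 1) * compNum p.2 j =
      (k + 1) * compNum (k + 1) (j + 1) := by
  induction k with
  | zero => cases j <;> simp
  | succ k ih =>
    have h : ∑ p ∈ antidiagonal (k + 1), (p.1 + 1) * compNum p.2 j =
        ∑ p ∈ antidiagonal k, (p.1 + 1) * compNum p.2 j + compNum (k + 2) (j + 1) := by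
      rw [← sum_compNum (k + 1) j, Finset.Nat.sum_antidiagonal_succ,
        Finset.Nat.sum_antidiagonal_succ, add_comm (compNum _ _), ← add_assoc,
        ← Finset.sum_add_distrib, add_comm]
      simp only [add_mul, one_mul, zero_add]
    rw [h, mul_add, ih]
    simp only [compNum_succ_succ]
    rcases lt_or_ge (k + 1) j with hj | hj
    · rw [Nat.choose_eq_zero_of_lt hj, Nat.choose_eq_zero_of_lt (by omega)]; simp
    · have := Nat.choose_mul_succ_eq k j
      obtain ⟨d, hd⟩ := Nat.exists_eq_add_of_le hj
      rw [show k + 1 - j = d by omega] at this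
      nlinarith

theorem sum_compNum_one_mul (r j : ℕ) :
    ∑ p ∈ antidiagonal r, compNum p.1 1 * compNum p.2 j = compNum r (j + 1) := by
  cases r with
  | zero => simp
  | succ r => simpa [Finset.Nat.sum_antidiagonal_succ] using sum_compNum r j

/-- The same symmetry with every part increased by one, so each composition contributes `r + (j +
1)`. The factor `compNum p.1 1` only says that the first part is positive. -/
theorem sum_mul_compNum_one_mul (r j : ℕ) :
    (j + 1) * ∑ p ∈ antidiagonal r, (p.1 + 1) * compNum p.1 1 * compNum p.2 j =
      (r + (j + 1)) * compNum r (j + 1) := by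
  have h : ∑ p ∈ antidiagonal r, (p.1 + 1) * compNum p.1 1 * compNum p.2 j =
      ∑ p ∈ antidiagonal r, p.1 * compNum p.1 1 * compNum p.2 j + compNum r (j + 1) := by
    rw [← sum_compNum_one_mul, ← Finset.sum_add_distrib]
    exact Finset.sum_congr rfl fun p _ => by ring
  have h2 : (j + 1) * ∑ p ∈ antidiagonal r, p.1 * compNum p.1 1 * compNum p.2 j =
      r * compNum r (j + 1) := by
    cases r with
    | zero => simp
    | succ r =>
      rw [← sum_mul_compNum r j]
      simp [Finset.Nat.sum_antidiagonal_succ]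
  rw [h, mul_add, h2]
  ring

theorem sum_compNum_zero_mul (r j : ℕ) :
    ∑ p ∈ antidiagonal r, compNum p.1 0 * compNum p.2 j = compNum r j := by
  cases r with
  | zero => simp
  | succ r => simp [Finset.Nat.sum_antidiagonal_succ]

/-! ### Divided powers of the excess of one gap -/

/-- The divided power `x ^ k / k!` as an extended nonnegative real. -/
noncomputable def dividedPow (k : ℕ) (x : ℝ) : ℝ≥0∞ := ENNReal.ofReal (x ^ k / k !)

theorem measurable_dividedPow (k : ℕ) : Measurable (dividedPow k) := by
  unfold dividedPow; fun_prop

theorem dividedPow_add (r : ℕ) {x y : ℝ} (hx : 0 ≤ x) (hy : 0 ≤ y) :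
    dividedPow r (x + y) = ∑ p ∈ antidiagonal r, dividedPow p.1 x * dividedPow p.2 y := by
  unfold dividedPow
  rw [(Commute.all x y).add_pow', Finset.sum_div, ENNReal.ofReal_sum_of_nonneg]
  · refine Finset.sum_congr rfl fun p hp => ?_
    rw [← ENNReal.ofReal_mul (by positivity)]
    congr 1
    rw [Finset.HasAntidiagonal.mem_antidiagonal] at hp
    subst hp
    have := Nat.add_choose_mul_factorial_mul_factorial p.1 p.2
    rw [← Nat.choose_symm_add] at this
    have h2 : (((p.1 + p.2).choose p.1 : ℕ) : ℝ) * p.1 ! * p.2 ! = (p.1 + p.2)! := by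
      exact_mod_cast this
    rw [nsmul_eq_mul, ← h2]
    have := (Nat.choose_pos (Nat.le_add_right p.1 p.2)).ne'
    field_simp
  · intro p _
    positivity

/-- The divided powers of `max (t - c) 0`, for `t ≥ 0`, extended by zero to `t < 0`. -/
noncomputable def excessPow (c : ℝ) (i : ℕ) (t : ℝ) : ℝ≥0∞ :=
  compNum i 0 * truncPow i t + compNum i 1 * truncPow i (t - c)

theorem measurable_excessPow (c : ℝ) (i : ℕ) : Measurable (excessPow c i) := by
  unfold excessPow
  exact ((measurable_truncPow i).const_mul _).add ((measurable_truncPow_sub i c).const_mul _)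

theorem excessPow_of_neg {c : ℝ} (hc : 0 ≤ c) (i : ℕ) {t : ℝ} (ht : t < 0) :
    excessPow c i t = 0 := by
  simp [excessPow, truncPow_of_neg ht, truncPow_of_neg (show t - c < 0 by linarith)]

/-- Degree zero is constant and sees no threshold; positive degrees are supported on `t ≥ c`. The
factors `compNum i 0` and `compNum i 1` select the case. -/
theorem excessPow_of_nonneg (c : ℝ) (i : ℕ) {t : ℝ} (ht : 0 ≤ t) :
    excessPow c i t = dividedPow i (max (t - c) 0) := by
  unfold excessPow dividedPow
  cases i with
  | zero => simp [truncPow_of_nonneg ht]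
  | succ i =>
    simp only [compNum_succ_zero, compNum_succ_one, Nat.cast_zero, zero_mul, zero_add,
      Nat.cast_one, one_mul]
    rcases lt_or_ge (t - c) 0 with h | h
    · rw [truncPow_of_neg h, max_eq_right h.le]
      simp
    · rw [truncPow_of_nonneg h, max_eq_left h]

theorem ofReal_mul_excessPow {c : ℝ} (hc : 0 ≤ c) (i : ℕ) (t : ℝ) :
    ENNReal.ofReal t * excessPow c i t =
      compNum i 0 * truncPow (i + 1) t + (((i + 1) * compNum i 1 : ℕ) : ℝ≥0∞) *
        truncPow (i + 1) (t - c) + compNum i 1 * ENNReal.ofReal c * truncPow i (t - c) := by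
  have h1 := ofReal_add_mul_truncPow (p := i) (x := t - c) hc
  have h0 := ofReal_add_mul_truncPow (p := i) (x := t) le_rfl
  have h2 : ((compNum i 0 : ℕ) : ℝ≥0∞) * (i + 1) = (compNum i 0 : ℕ) := by
    cases i <;> simp
  simp only [sub_add_cancel, add_zero, ENNReal.ofReal_zero, zero_mul] at h1 h0
  unfold excessPow
  rw [mul_add, mul_left_comm, h0, ← mul_assoc, h2, mul_left_comm, h1]
  push_cast
  ring

theorem lintegral_truncPow_mul_excessPow (c b l : ℝ) (p i : ℕ) :
    ∫⁻ t, truncPow p (t - b) * excessPow c i (l - t) =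
      compNum i 0 * truncPow (p + i + 1) (l - b) +
        compNum i 1 * truncPow (p + i + 1) (l - b - c) := by
  have m1 : Measurable fun t => truncPow p (t - b) * truncPow i (l - t - 0) :=
    (measurable_truncPow_sub p b).mul (measurable_truncPow_sub_sub i l 0)
  have m2 : Measurable fun t => truncPow p (t - b) * truncPow i (l - t - c) :=
    (measurable_truncPow_sub p b).mul (measurable_truncPow_sub_sub i l c)
  have : ∀ t, truncPow p (t - b) * excessPow c i (l - t) =
      compNum i 0 * (truncPow p (t - b) * truncPow i (l - t - 0)) +
        compNum i 1 * (truncPow p (t - b) * truncPow i (l - t - c)) := fun t => by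
    unfold excessPow
    rw [sub_zero]
    ring
  simp_rw [this]
  rw [lintegral_add_left (m1.const_mul _), lintegral_const_mul _ m1, lintegral_const_mul _ m2,
    lintegral_truncPow_mul, lintegral_truncPow_mul, sub_zero]

theorem lintegral_truncPow_mul_ofReal_mul_excessPow {c : ℝ} (hc : 0 ≤ c) (b l : ℝ) (p i : ℕ) :
    ∫⁻ t, truncPow p (t - b) * (ENNReal.ofReal (l - t) * excessPow c i (l - t)) =
      compNum i 0 * truncPow (p + i + 2) (l - b) +
        (((i + 1) * compNum i 1 : ℕ) : ℝ≥0∞) * truncPow (p + i + 2) (l - b - c) +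
        compNum i 1 * ENNReal.ofReal c * truncPow (p + i + 1) (l - b - c) := by
  have m (q : ℕ) (d : ℝ) : Measurable fun t => truncPow p (t - b) * truncPow q (l - t - d) :=
    (measurable_truncPow_sub p b).mul (measurable_truncPow_sub_sub q l d)
  have : ∀ t, truncPow p (t - b) * (ENNReal.ofReal (l - t) * excessPow c i (l - t)) =
      compNum i 0 * (truncPow p (t - b) * truncPow (i + 1) (l - t - 0)) +
        (((i + 1) * compNum i 1 : ℕ) : ℝ≥0∞) *
          (truncPow p (t - b) * truncPow (i + 1) (l - t - c)) +
        compNum i 1 * ENNReal.ofReal c * (truncPow p (t - b) * truncPow i (l - t - c)) :=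
    fun t => by
      rw [ofReal_mul_excessPow hc, sub_zero]
      ring
  simp_rw [this]
  rw [lintegral_add_right _ ((m _ _).const_mul _),
    lintegral_add_left ((m _ _).const_mul _), lintegral_const_mul _ (m _ _),
    lintegral_const_mul _ (m _ _), lintegral_const_mul _ (m _ _),
    lintegral_truncPow_mul, lintegral_truncPow_mul, lintegral_truncPow_mul, sub_zero]
  rfl

/-! ### Ordered points and their gaps -/

/-- The sum of `h` over the `m + 1` gaps which `m` increasing points cut out of `[0, l]`. -/
def gapSum (h : ℝ → ℝ) : (m : ℕ) → (Fin m → ℝ) → ℝ → ℝ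
  | 0, _, l => h l
  | m + 1, y, l =>
    h (l - y (Fin.last m)) + gapSum h m (fun i => y i.castSucc) (y (Fin.last m))

/-- The relation `0 < y 0 < ⋯ < y (m - 1) < l`. -/
def OrderedBelow : (m : ℕ) → (Fin m → ℝ) → ℝ → Prop
  | 0, _, l => 0 < l
  | m + 1, y, l =>
    y (Fin.last m) < l ∧ OrderedBelow m (fun i => y i.castSucc) (y (Fin.last m))

theorem OrderedBelow.pos {m : ℕ} {y : Fin m → ℝ} {l : ℝ} (h : OrderedBelow m y l) : 0 < l := by
  induction m generalizing l with
  | zero => exact h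
  | succ m ih => exact (ih h.2).trans h.1

theorem gapSum_nonneg {h : ℝ → ℝ} (hh : ∀ t, 0 ≤ h t) (m : ℕ) (y : Fin m → ℝ) (l : ℝ) :
    0 ≤ gapSum h m y l := by
  induction m generalizing l with
  | zero => exact hh l
  | succ m ih => exact add_nonneg (hh _) (ih _ _)

theorem measurable_gapSum {h : ℝ → ℝ} (hh : Measurable h) (m : ℕ) :
    Measurable fun q : (Fin m → ℝ) × ℝ => gapSum h m q.1 q.2 := by
  induction m with
  | zero => exact hh.comp measurable_snd
  | succ m ih =>
    have hp : Measurable fun q : (Fin (m + 1) → ℝ) × ℝ =>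
        ((fun i : Fin m => q.1 i.castSucc), q.1 (Fin.last m)) := by fun_prop
    exact (hh.comp (by fun_prop)).add (ih.comp hp)

theorem measurableSet_orderedBelow (m : ℕ) :
    MeasurableSet {q : (Fin m → ℝ) × ℝ | OrderedBelow m q.1 q.2} := by
  induction m with
  | zero => exact measurableSet_lt measurable_const measurable_snd
  | succ m ih =>
    have hp : Measurable fun q : (Fin (m + 1) → ℝ) × ℝ =>
        ((fun i : Fin m => q.1 i.castSucc), q.1 (Fin.last m)) := by fun_prop
    exact (measurableSet_lt (f := fun q : (Fin (m + 1) → ℝ) × ℝ => q.1 (Fin.last m))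
      (by fun_prop) measurable_snd).inter (hp ih)

theorem lintegral_fin_succ_last {m : ℕ} {F : (Fin (m + 1) → ℝ) → ℝ≥0∞} (hF : Measurable F) :
    ∫⁻ y, F y = ∫⁻ t, ∫⁻ y : Fin m → ℝ, F (Fin.snoc y t) := by
  have e := (volume_preserving_piFinSuccAbove (fun _ : Fin (m + 1) => ℝ) (Fin.last m)).symm
  rw [← e.lintegral_comp hF, Measure.volume_eq_prod, lintegral_prod]
  · refine lintegral_congr fun t => lintegral_congr fun y => ?_
    simp [MeasurableEquiv.piFinSuccAbove, Fin.insertNthEquiv, Fin.insertNth_last']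
  · exact (hF.comp e.measurable).aemeasurable

theorem lintegral_fin_succ_zero {m : ℕ} {F : (Fin (m + 1) → ℝ) → ℝ≥0∞} (hF : Measurable F) :
    ∫⁻ y, F y = ∫⁻ t, ∫⁻ y : Fin m → ℝ, F (Fin.cons t y) := by
  have e := (volume_preserving_piFinSuccAbove (fun _ : Fin (m + 1) => ℝ) 0).symm
  rw [← e.lintegral_comp hF, Measure.volume_eq_prod, lintegral_prod]
  · refine lintegral_congr fun t => lintegral_congr fun y => ?_
    simp [MeasurableEquiv.piFinSuccAbove, Fin.insertNthEquiv]
  · exact (hF.comp e.measurable).aemeasurable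

/-! ### Integrals of the total excess over ordered points -/

/-- The excess of a gap of length `t` over `c`. -/
noncomputable def excess (c t : ℝ) : ℝ := max (t - c) 0

theorem excess_nonneg (c t : ℝ) : 0 ≤ excess c t := le_max_right _ _

theorem measurable_excess (c : ℝ) : Measurable (excess c) := by
  unfold excess; fun_prop

/-- The integral of the `k`-th divided power of the total excess over `c` of the gaps cut out of
`[0, l]` by `m` ordered points. -/
noncomputable def excessIntegral (c : ℝ) (m k : ℕ) (l : ℝ) : ℝ≥0∞ :=
  ∑ j ∈ Finset.range (m + 2),
    (((m + 1).choose j * compNum k j : ℕ) : ℝ≥0∞) * truncPow (m + k) (l - j * c)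

theorem excessIntegral_of_neg {c : ℝ} (hc : 0 ≤ c) (m k : ℕ) {l : ℝ} (hl : l < 0) :
    excessIntegral c m k l = 0 := by
  refine Finset.sum_eq_zero fun j _ => ?_
  rw [truncPow_of_neg, mul_zero]
  have : 0 ≤ (j : ℝ) * c := by positivity
  linarith

theorem measurable_orderedBelow_indicator (c : ℝ) (w : ℝ → ℝ≥0∞) (hw : Measurable w) (m k : ℕ)
    (l : ℝ) : Measurable ({y : Fin (m + 1) → ℝ | OrderedBelow (m + 1) y l}.indicator
      fun y => w (l - y (Fin.last m)) * dividedPow k (gapSum (excess c) (m + 1) y l)) := by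
  refine Measurable.indicator ?_ ((measurableSet_orderedBelow (m + 1)).preimage
    (measurable_id.prodMk measurable_const))
  exact (hw.comp (by fun_prop)).mul ((measurable_dividedPow k).comp
    ((measurable_gapSum (measurable_excess c) (m + 1)).comp
      (measurable_id.prodMk measurable_const)))

/-- Condition on the largest point `t`: the last gap is `l - t`, the other points are ordered below
`t`, and `dividedPow_add` separates the two excesses. A weight in the last gap alone survives the
splitting; it is used with `w = 1` and with the gap length. -/
theorem lintegral_weighted_gapSum {c : ℝ} (hc : 0 ≤ c) {m : ℕ} (r : ℕ) (l : ℝ) {w : ℝ → ℝ≥0∞}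
    (hw : Measurable w)
    (ih : ∀ k t, 0 < t → ∫⁻ y : Fin m → ℝ, {y | OrderedBelow m y t}.indicator
      (fun y => dividedPow k (gapSum (excess c) m y t)) y = excessIntegral c m k t) :
    ∫⁻ y : Fin (m + 1) → ℝ, {y | OrderedBelow (m + 1) y l}.indicator
      (fun y => w (l - y (Fin.last m)) * dividedPow r (gapSum (excess c) (m + 1) y l)) y =
    ∑ p ∈ antidiagonal r, ∑ j ∈ Finset.range (m + 2),
      (((m + 1).choose j * compNum p.2 j : ℕ) : ℝ≥0∞) *
        ∫⁻ t, truncPow (m + p.2) (t - j * c) * (w (l - t) * excessPow c p.1 (l - t)) := by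
  have hI (k : ℕ) (t : ℝ) : Measurable ({y : Fin m → ℝ | OrderedBelow m y t}.indicator
      fun y => dividedPow k (gapSum (excess c) m y t)) :=
    Measurable.indicator ((measurable_dividedPow k).comp
      ((measurable_gapSum (measurable_excess c) m).comp (measurable_id.prodMk measurable_const)))
      ((measurableSet_orderedBelow m).preimage (measurable_id.prodMk measurable_const))
  have hJ (p : ℕ × ℕ) (j : ℕ) : Measurable fun t =>
      truncPow (m + p.2) (t - j * c) * (w (l - t) * excessPow c p.1 (l - t)) :=
    (measurable_truncPow_sub _ _).mul ((hw.comp (by fun_prop)).mul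
      ((measurable_excessPow c p.1).comp (by fun_prop)))
  rw [lintegral_fin_succ_last (measurable_orderedBelow_indicator c w hw m r l)]
  trans ∫⁻ t, ∑ p ∈ antidiagonal r, ∑ j ∈ Finset.range (m + 2),
      (((m + 1).choose j * compNum p.2 j : ℕ) : ℝ≥0∞) *
        (truncPow (m + p.2) (t - j * c) * (w (l - t) * excessPow c p.1 (l - t)))
  swap
  · rw [lintegral_finsetSum _ fun p _ => Finset.measurable_sum _ fun j _ => (hJ p j).const_mul _]
    refine Finset.sum_congr rfl fun p _ => ?_
    rw [lintegral_finsetSum _ fun j _ => (hJ p j).const_mul _]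
    exact Finset.sum_congr rfl fun j _ => lintegral_const_mul _ (hJ p j)
  refine lintegral_congr_ae ?_
  -- The endpoints are excluded because truncated powers of degree zero equal one at zero, whereas
  -- `OrderedBelow` is strict.
  filter_upwards [((Set.finite_singleton l).insert 0).countable.ae_notMem volume] with t ht
  simp only [Set.mem_insert_iff, Set.mem_singleton_iff, not_or] at ht
  trans ∑ p ∈ antidiagonal r,
    w (l - t) * excessPow c p.1 (l - t) * excessIntegral c m p.2 t
  swap
  · refine Finset.sum_congr rfl fun p _ => ?_
    rw [excessIntegral, Finset.mul_sum]
    exact Finset.sum_congr rfl fun j _ => by ring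
  have hmem : ∀ y : Fin m → ℝ, OrderedBelow (m + 1) (Fin.snoc y t : Fin (m + 1) → ℝ) l ↔
      t < l ∧ OrderedBelow m y t := fun y => by
    simp [OrderedBelow]
  have hsum : ∀ y : Fin m → ℝ, gapSum (excess c) (m + 1) (Fin.snoc y t : Fin (m + 1) → ℝ) l =
      excess c (l - t) + gapSum (excess c) m y t := fun y => by
    simp [gapSum]
  rcases lt_or_gt_of_ne ht.1 with h0 | h0
  · rw [Finset.sum_eq_zero fun p _ => by rw [excessIntegral_of_neg hc m p.2 h0, mul_zero]]
    rw [← lintegral_zero (μ := (volume : Measure (Fin m → ℝ)))]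
    refine lintegral_congr fun y => Set.indicator_of_notMem ?_ _
    rw [Set.mem_ofPred_eq, hmem]
    exact fun h => (h.2.pos.trans h0).false
  rcases lt_or_gt_of_ne ht.2 with h1 | h1
  swap
  · rw [Finset.sum_eq_zero fun p _ => by
      rw [excessPow_of_neg hc p.1 (sub_neg.2 h1), mul_zero, zero_mul]]
    rw [← lintegral_zero (μ := (volume : Measure (Fin m → ℝ)))]
    refine lintegral_congr fun y => Set.indicator_of_notMem ?_ _
    rw [Set.mem_ofPred_eq, hmem]
    exact fun h => (h.1.trans h1).false
  · simp_rw [← ih _ t h0, ← lintegral_const_mul _ (hI _ t)]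
    rw [← lintegral_finsetSum _ fun p _ => (hI _ t).const_mul _]
    refine lintegral_congr fun y => ?_
    by_cases hy : OrderedBelow m y t
    · have hy' : (Fin.snoc y t : Fin (m + 1) → ℝ) ∈ {y | OrderedBelow (m + 1) y l} :=
        (hmem y).2 ⟨h1, hy⟩
      have hy : y ∈ {y | OrderedBelow m y t} := hy
      rw [Set.indicator_of_mem hy', hsum,
        dividedPow_add r (excess_nonneg _ _) (gapSum_nonneg (excess_nonneg c) m y t),
        Finset.mul_sum]
      refine Finset.sum_congr rfl fun p _ => ?_
      rw [Set.indicator_of_mem hy, excessPow_of_nonneg c p.1 (sub_nonneg.2 h1.le), mul_assoc]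
      simp [excess]
    · have hy' : (Fin.snoc y t : Fin (m + 1) → ℝ) ∉ {y | OrderedBelow (m + 1) y l} :=
        fun h => hy ((hmem y).1 h).2
      have hy : y ∉ {y | OrderedBelow m y t} := hy
      rw [Set.indicator_of_notMem hy']
      symm
      refine Finset.sum_eq_zero fun p _ => ?_
      rw [Set.indicator_of_notMem hy, mul_zero]

theorem sum_compNum_mul_antidiagonal {r m : ℕ} (f : ℕ × ℕ → ℕ) (T : ℕ → ℝ≥0∞) :
    ∑ p ∈ antidiagonal r, ∑ j ∈ Finset.range (m + 2),
      (((m + 1).choose j * compNum p.2 j : ℕ) : ℝ≥0∞) * ((f p : ℕ) * T j) =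
    ∑ j ∈ Finset.range (m + 2), (((m + 1).choose j *
      ∑ p ∈ antidiagonal r, f p * compNum p.2 j : ℕ) : ℝ≥0∞) * T j := by
  rw [Finset.sum_comm]
  refine Finset.sum_congr rfl fun j _ => ?_
  rw [Finset.mul_sum, Nat.cast_sum, Finset.sum_mul]
  exact Finset.sum_congr rfl fun p _ => by push_cast; ring

theorem lintegral_gapSum {c : ℝ} (hc : 0 ≤ c) (m k : ℕ) {l : ℝ} (hl : 0 < l) :
    ∫⁻ y : Fin m → ℝ, {y | OrderedBelow m y l}.indicator
      (fun y => dividedPow k (gapSum (excess c) m y l)) y = excessIntegral c m k l := by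
  induction m generalizing k l with
  | zero =>
    have hmem : ∀ y : Fin 0 → ℝ, y ∈ {y | OrderedBelow 0 y l} := fun _ => hl
    rw [lintegral_congr fun y => Set.indicator_of_mem (hmem y) _, lintegral_unique]
    have := excessPow_of_nonneg c k hl.le
    rw [excessPow] at this
    simp only [gapSum, excess, excessIntegral]
    rw [← this]
    simp [Finset.sum_range_succ, volume_pi]
  | succ m ih =>
    have h := lintegral_weighted_gapSum hc (m := m) k l (w := fun _ => 1) measurable_const
      fun k t ht => ih k ht
    simp only [one_mul] at h
    rw [h]
    have hp : ∀ p ∈ antidiagonal k, ∀ j ∈ Finset.range (m + 2),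
        (((m + 1).choose j * compNum p.2 j : ℕ) : ℝ≥0∞) *
          ∫⁻ t, truncPow (m + p.2) (t - j * c) * excessPow c p.1 (l - t) =
        (((m + 1).choose j * compNum p.2 j : ℕ) : ℝ≥0∞) *
          (compNum p.1 0 * truncPow (m + 1 + k) (l - j * c)) +
        (((m + 1).choose j * compNum p.2 j : ℕ) : ℝ≥0∞) *
          (compNum p.1 1 * truncPow (m + 1 + k) (l - (j + 1 : ℕ) * c)) := fun p hp j _ => by
      rw [Finset.HasAntidiagonal.mem_antidiagonal] at hp
      rw [lintegral_truncPow_mul_excessPow, mul_add,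
        show m + p.2 + p.1 + 1 = m + 1 + k by omega]
      push_cast
      rw [show l - j * c - c = l - (j + 1) * c by ring]
    rw [Finset.sum_congr rfl fun p h => Finset.sum_congr rfl (hp p h)]
    simp_rw [Finset.sum_add_distrib]
    rw [sum_compNum_mul_antidiagonal (fun p => compNum p.1 0) fun j =>
        truncPow (m + 1 + k) (l - j * c),
      sum_compNum_mul_antidiagonal (fun p => compNum p.1 1) fun j =>
        truncPow (m + 1 + k) (l - (j + 1 : ℕ) * c)]
    simp_rw [sum_compNum_zero_mul, sum_compNum_one_mul]
    rw [excessIntegral, Finset.sum_range_succ' _ (m + 2), Finset.sum_range_succ' _ (m + 1)]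
    -- Pascal's rule: the new gap either stays at degree zero, keeping `j`, or has positive degree,
    -- raising `j` by one.
    have : ∀ j ∈ Finset.range (m + 2),
        (((m + 2).choose (j + 1) * compNum k (j + 1) : ℕ) : ℝ≥0∞) *
          truncPow (m + 1 + k) (l - (j + 1 : ℕ) * c) =
        (((m + 1).choose (j + 1) * compNum k (j + 1) : ℕ) : ℝ≥0∞) *
          truncPow (m + 1 + k) (l - (j + 1 : ℕ) * c) +
        (((m + 1).choose j * compNum k (j + 1) : ℕ) : ℝ≥0∞) *
          truncPow (m + 1 + k) (l - (j + 1 : ℕ) * c) := fun j _ => by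
      rw [Nat.choose_succ_succ (m + 1) j]
      push_cast
      ring
    have h0 : (((m + 1).choose (m + 1 + 1) : ℕ) : ℝ≥0∞) = 0 := by
      rw [Nat.choose_succ_self, Nat.cast_zero]
    rw [Finset.sum_congr rfl this, Finset.sum_add_distrib,
      Finset.sum_range_succ (fun j => (((m + 1).choose (j + 1) * _ : ℕ) : ℝ≥0∞) * _) (m + 1),
      Nat.cast_mul ((m + 1).choose (m + 1 + 1)), h0, zero_mul, zero_mul, add_zero,
      Finset.sum_range_succ (fun j => (((m + 1).choose j * _ : ℕ) : ℝ≥0∞) * _) (m + 1)]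
    simp only [Nat.choose_zero_right]
    ring

/-- The `m + 2` gaps are exchangeable and sum to `l`, so weighting by one of them gives a fraction
`1 / (m + 2)` of weighting by `l`. This is verified by comparing coefficients. -/
theorem mul_lintegral_weighted_gapSum {c : ℝ} (hc : 0 ≤ c) (m r : ℕ) (l : ℝ) :
    (m + 2 : ℕ) * ∫⁻ y : Fin (m + 1) → ℝ, {y | OrderedBelow (m + 1) y l}.indicator
      (fun y => ENNReal.ofReal (l - y (Fin.last m)) *
        dividedPow r (gapSum (excess c) (m + 1) y l)) y =
    ENNReal.ofReal l * excessIntegral c (m + 1) r l := by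
  rw [lintegral_weighted_gapSum hc r l ENNReal.measurable_ofReal
    fun k t ht => lintegral_gapSum hc m k ht]
  have hp : ∀ p ∈ antidiagonal r, ∀ j ∈ Finset.range (m + 2),
      (((m + 1).choose j * compNum p.2 j : ℕ) : ℝ≥0∞) *
        ∫⁻ t, truncPow (m + p.2) (t - j * c) *
          (ENNReal.ofReal (l - t) * excessPow c p.1 (l - t)) =
      (((m + 1).choose j * compNum p.2 j : ℕ) : ℝ≥0∞) *
        (compNum p.1 0 * truncPow (m + r + 2) (l - j * c)) +
      (((m + 1).choose j * compNum p.2 j : ℕ) : ℝ≥0∞) *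
        (((p.1 + 1) * compNum p.1 1 : ℕ) * truncPow (m + r + 2) (l - (j + 1 : ℕ) * c)) +
      (((m + 1).choose j * compNum p.2 j : ℕ) : ℝ≥0∞) *
        (compNum p.1 1 * (ENNReal.ofReal c * truncPow (m + r + 1) (l - (j + 1 : ℕ) * c))) :=
    fun p hp j _ => by
      rw [Finset.HasAntidiagonal.mem_antidiagonal] at hp
      rw [lintegral_truncPow_mul_ofReal_mul_excessPow hc, mul_add, mul_add,
        show m + p.2 + p.1 + 1 = m + r + 1 by omega,
        show m + p.2 + p.1 + 2 = m + r + 2 by omega]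
      push_cast
      rw [show l - j * c - c = l - (j + 1) * c by ring]
      ring
  rw [Finset.sum_congr rfl fun p h => Finset.sum_congr rfl (hp p h)]
  simp_rw [Finset.sum_add_distrib]
  rw [sum_compNum_mul_antidiagonal (fun p => compNum p.1 0) fun j =>
      truncPow (m + r + 2) (l - j * c),
    sum_compNum_mul_antidiagonal (fun p => (p.1 + 1) * compNum p.1 1) fun j =>
      truncPow (m + r + 2) (l - (j + 1 : ℕ) * c),
    sum_compNum_mul_antidiagonal (fun p => compNum p.1 1) fun j =>
      ENNReal.ofReal c * truncPow (m + r + 1) (l - (j + 1 : ℕ) * c)]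
  simp_rw [sum_compNum_zero_mul, sum_compNum_one_mul]
  -- Write `l = (l - j c) + j c`. The first summand raises the degree and produces the factor `m + 2
  -- + r`, split as `(m + 2 - j) + (r + j)` to match the unshifted and shifted terms on the left.
  have hR : ENNReal.ofReal l * excessIntegral c (m + 1) r l =
      ∑ j ∈ Finset.range (m + 3), ((((m + 2).choose j * (m + 2 - j) * compNum r j : ℕ) : ℝ≥0∞) *
        truncPow (m + r + 2) (l - j * c) +
      ((((m + 2).choose j * ((r + j) * compNum r j) : ℕ) : ℝ≥0∞) *
        truncPow (m + r + 2) (l - j * c) +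
      (((m + 2).choose j * j * compNum r j : ℕ) : ℝ≥0∞) *
        (ENNReal.ofReal c * truncPow (m + r + 1) (l - j * c)))) := by
    rw [excessIntegral, Finset.mul_sum]
    refine Finset.sum_congr rfl fun j hj => ?_
    have h := ofReal_add_mul_truncPow (p := m + r + 1) (x := l - j * c) (d := j * c)
      (by positivity)
    rw [sub_add_cancel, ENNReal.ofReal_mul (Nat.cast_nonneg j), ENNReal.ofReal_natCast] at h
    rw [show m + 1 + r = m + r + 1 by ring, mul_left_comm, h]
    obtain ⟨d, hd⟩ := Nat.exists_eq_add_of_le (Nat.lt_succ_iff.1 (Finset.mem_range.1 hj))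
    have hd2 : m + 2 - j = d := by omega
    have hd3 : (m : ℝ≥0∞) + 2 = j + d := by exact_mod_cast hd
    rw [hd2]
    push_cast
    rw [show (m : ℝ≥0∞) + r + 1 + 1 = (m + 2) + r by ring, hd3]
    ring
  -- The unshifted part vanishes at `j = m + 2` and the shifted part at `j = 0`, so both sums run
  -- over `m + 2` indices.
  rw [hR, Finset.sum_add_distrib, Finset.sum_range_succ _ (m + 2),
    Finset.sum_range_succ' (fun j => _ + _ * (ENNReal.ofReal c * _)) (m + 2), add_assoc, mul_add]
  congr 1
  · rw [Nat.sub_self]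
    simp only [mul_zero, zero_mul, Nat.cast_zero, add_zero]
    rw [Finset.mul_sum]
    refine Finset.sum_congr rfl fun j _ => ?_
    rw [← mul_assoc, ← Nat.cast_mul, ← mul_assoc, mul_comm (m + 2), Nat.choose_mul_succ_eq]
  · have h0 : r * compNum r 0 = 0 := by cases r <;> simp
    simp only [add_zero, h0, mul_zero, zero_mul, Nat.cast_zero]
    rw [← Finset.sum_add_distrib, Finset.mul_sum]
    refine Finset.sum_congr rfl fun j _ => ?_
    have hch : (m + 2) * (m + 1).choose j = (m + 2).choose (j + 1) * (j + 1) :=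
      Nat.add_one_mul_choose_eq (m + 1) j
    rw [mul_add, ← mul_assoc, ← mul_assoc, ← Nat.cast_mul, ← Nat.cast_mul, ← mul_assoc,
      ← mul_assoc, hch, mul_assoc _ (j + 1), sum_mul_compNum_one_mul]
    congr 1
    rw [← hch]
    push_cast
    ring

/-! ### Cutting the circle at the first point -/

theorem gapSum_sub (h : ℝ → ℝ) {m : ℕ} (x : Fin (m + 1) → ℝ) (l : ℝ) :
    gapSum h m (fun i => x i.succ - x 0) (l - x 0) =
      ∑ i : Fin m, h (x i.succ - x i.castSucc) + h (l - x (Fin.last m)) := by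
  induction m generalizing l with
  | zero => simp [gapSum]
  | succ m ih =>
    have := ih (fun i => x i.castSucc) (x (Fin.last (m + 1)))
    rw [Fin.sum_univ_castSucc, gapSum]
    simp only [Fin.succ_last, sub_sub_sub_cancel_right, Fin.castSucc_zero] at this ⊢
    simp only [Fin.succ_castSucc]
    rw [this]
    ring

theorem orderedBelow_sub {m : ℕ} (x : Fin (m + 1) → ℝ) (l : ℝ) :
    OrderedBelow m (fun i => x i.succ - x 0) (l - x 0) ↔
      StrictMono x ∧ x (Fin.last m) < l := by
  induction m generalizing l with
  | zero => simp [OrderedBelow, Subsingleton.strictMono]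
  | succ m ih =>
    have := ih (fun i => x i.castSucc) (x (Fin.last (m + 1)))
    rw [OrderedBelow]
    simp only [Fin.succ_last, Fin.castSucc_zero, sub_lt_sub_iff_right] at this ⊢
    simp only [Fin.succ_castSucc]
    rw [this, Fin.strictMono_iff_lt_succ, Fin.strictMono_iff_lt_succ,
      Fin.forall_fin_succ' (P := fun i : Fin (m + 1) => x i.castSucc < x i.succ), Fin.succ_last]
    simp only [Fin.succ_castSucc]
    tauto

/-- The total excess over `c` of the gaps between increasing points on a circle of
circumference `L`. -/
noncomputable def circleExcess (c L : ℝ) {m : ℕ} (x : Fin (m + 1) → ℝ) : ℝ :=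
  ∑ i : Fin m, excess c (x i.succ - x i.castSucc) + excess c (x 0 - x (Fin.last m) + L)

theorem measurable_circleExcess (c L : ℝ) (m : ℕ) :
    Measurable fun x : Fin (m + 1) → ℝ => circleExcess c L x := by
  unfold circleExcess excess
  fun_prop

/-- Increasing tuples in `[0, L)`. -/
def increasingTuples (n : ℕ) (L : ℝ) : Set (Fin n → ℝ) :=
  {x | StrictMono x} ∩ Set.univ.pi fun _ => Set.Ico 0 L

theorem measurableSet_increasingTuples (n : ℕ) (L : ℝ) :
    MeasurableSet (increasingTuples n L) := by
  refine MeasurableSet.inter ?_ (MeasurableSet.univ_pi fun _ => measurableSet_Ico)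
  have : {x : Fin n → ℝ | StrictMono x} =
      ⋂ i, ⋂ j, ⋂ _ : i < j, {x : Fin n → ℝ | x i < x j} := by
    ext x
    simp [StrictMono]
  rw [this]
  exact .iInter fun i => .iInter fun j => .iInter fun _ =>
    measurableSet_lt (measurable_pi_apply i) (measurable_pi_apply j)

theorem mem_increasingTuples_iff {m : ℕ} {L : ℝ} {x : Fin (m + 1) → ℝ} :
    x ∈ increasingTuples (m + 1) L ↔ StrictMono x ∧ 0 ≤ x 0 ∧ x (Fin.last m) < L := by
  refine ⟨fun h => ⟨h.1, (h.2 0 trivial).1, (h.2 (Fin.last m) trivial).2⟩, fun h => ⟨h.1, ?_⟩⟩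
  exact fun i _ => ⟨h.2.1.trans (h.1.monotone (Fin.zero_le i)),
    (h.1.monotone (Fin.le_last i)).trans_lt h.2.2⟩

theorem cons_add_mem_increasingTuples_iff {m : ℕ} {L u : ℝ} {y : Fin (m + 1) → ℝ} :
    (Fin.cons u (y + fun _ => u) : Fin (m + 2) → ℝ) ∈ increasingTuples (m + 2) L ↔
      u ∈ Set.Ico 0 (L - y (Fin.last m)) ∧
        OrderedBelow m (fun i => y i.castSucc) (y (Fin.last m)) := by
  have := orderedBelow_sub (Fin.cons u (y + fun _ => u) : Fin (m + 2) → ℝ) L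
  simp only [Fin.cons_succ, Fin.cons_zero, Pi.add_apply, add_sub_cancel_right] at this
  rw [mem_increasingTuples_iff, and_left_comm, ← this, OrderedBelow, Fin.cons_zero, Set.mem_Ico,
    and_assoc, lt_sub_comm]

theorem circleExcess_cons_add {m : ℕ} (c L u : ℝ) (y : Fin (m + 1) → ℝ) :
    circleExcess c L (Fin.cons u (y + fun _ => u) : Fin (m + 2) → ℝ) =
      gapSum (excess c) (m + 1) y L := by
  have := gapSum_sub (excess c) (Fin.cons u (y + fun _ => u) : Fin (m + 2) → ℝ) (L + u)
  simp only [Fin.cons_succ, Fin.cons_zero, Pi.add_apply, add_sub_cancel_right] at this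
  rw [this, circleExcess, Fin.cons_zero]
  congr 2
  ring

/-- In the coordinates given by the first point `u` and the offsets `y` from it, the excess is
independent of `u`, and `u` ranges over an interval whose length is the last gap `L - y (Fin.last
m)`. -/
theorem lintegral_circleExcess (c L : ℝ) (m r : ℕ) :
    ∫⁻ x, (increasingTuples (m + 2) L).indicator
      (fun x => dividedPow r (circleExcess c L x)) x =
    ∫⁻ y : Fin (m + 1) → ℝ, {y | OrderedBelow (m + 1) y L}.indicator
      (fun y => ENNReal.ofReal (L - y (Fin.last m)) *
        dividedPow r (gapSum (excess c) (m + 1) y L)) y := by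
  set F : (Fin (m + 2) → ℝ) → ℝ≥0∞ := (increasingTuples (m + 2) L).indicator
    (fun x => dividedPow r (circleExcess c L x)) with hFdef
  have hF : Measurable F := ((measurable_dividedPow r).comp
    (measurable_circleExcess c L (m + 1))).indicator (measurableSet_increasingTuples _ L)
  rw [lintegral_fin_succ_zero hF]
  have h1 : ∀ u : ℝ, ∫⁻ y : Fin (m + 1) → ℝ, F (Fin.cons u y) =
      ∫⁻ y : Fin (m + 1) → ℝ, F (Fin.cons u (y + fun _ => u)) := fun u =>
    (lintegral_add_right_eq_self (fun y : Fin (m + 1) → ℝ => F (Fin.cons u y)) fun _ => u).symm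
  simp_rw [h1]
  have hc : Measurable fun q : ℝ × (Fin (m + 1) → ℝ) =>
      (Fin.cons q.1 (q.2 + fun _ => q.1) : Fin (m + 2) → ℝ) := by
    refine measurable_pi_iff.2 fun i => ?_
    refine Fin.cases ?_ (fun i => ?_) i
    · simpa using measurable_fst
    · simp only [Fin.cons_succ, Pi.add_apply]
      fun_prop
  rw [lintegral_lintegral_swap
    (f := fun (u : ℝ) (y : Fin (m + 1) → ℝ) => F (Fin.cons u (y + fun _ => u)))
    (hF.comp hc).aemeasurable]
  refine lintegral_congr fun y => ?_
  have h2 : ∀ u, F (Fin.cons u (y + fun _ => u)) = (Set.Ico 0 (L - y (Fin.last m))).indicator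
      (fun _ => {y : Fin (m + 1) → ℝ |
        OrderedBelow m (fun i => y i.castSucc) (y (Fin.last m))}.indicator
          (fun y => dividedPow r (gapSum (excess c) (m + 1) y L)) y) u := fun u => by
    classical
    rw [hFdef]
    simp only [Set.indicator_apply, cons_add_mem_increasingTuples_iff, circleExcess_cons_add,
      Set.mem_ofPred_eq, ite_and]
  simp_rw [h2]
  rw [lintegral_indicator measurableSet_Ico, setLIntegral_const, Real.volume_Ico, sub_zero]
  classical
  simp only [Set.indicator_apply, Set.mem_ofPred_eq, OrderedBelow, ite_and]
  split_ifs with h3 h4 h4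
  · ring
  · rw [ENNReal.ofReal_of_nonpos (by linarith), mul_zero]
  · simp
  · simp

/-! ### Symmetrization over the orderings -/

theorem ae_injective_pi (n : ℕ) : ∀ᵐ x : Fin n → ℝ, Function.Injective x := by
  have h : ∀ i j : Fin n, ∀ᵐ x : Fin n → ℝ, i ≠ j → x i ≠ x j := fun i j => by
    by_cases hij : i = j
    · simp [hij]
    · let s : Submodule ℝ (Fin n → ℝ) :=
        LinearMap.ker ((LinearMap.proj i : (Fin n → ℝ) →ₗ[ℝ] ℝ) - LinearMap.proj j)
      have hs : s ≠ ⊤ := fun h => by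
        have : (Pi.single i 1 : Fin n → ℝ) ∈ s := h ▸ Submodule.mem_top
        have h2 : (Pi.single i 1 : Fin n → ℝ) j = 0 := Pi.single_eq_of_ne (Ne.symm hij) _
        simp [s, h2] at this
      have h0 := Measure.addHaar_submodule (volume : Measure (Fin n → ℝ)) s hs
      filter_upwards [measure_eq_zero_iff_ae_notMem.1 h0] with x hx _ he
      exact hx (by simp [s, he])
  have h' := ae_all_iff.2 fun i => ae_all_iff.2 fun j => h i j
  filter_upwards [h'] with x hx i j hij
  by_contra hne
  exact hx i j hne hij

theorem sort_eq_of_strictMono {n : ℕ} {x : Fin n → ℝ} {σ : Equiv.Perm (Fin n)}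
    (h : StrictMono (x ∘ σ)) : Tuple.sort x = σ := by
  symm
  rw [Tuple.eq_sort_iff]
  exact ⟨h.monotone, fun i j hij he => absurd he (h hij).ne⟩

theorem measurePreserving_comp_perm {n : ℕ} (σ : Equiv.Perm (Fin n)) :
    MeasurePreserving (fun x : Fin n → ℝ => x ∘ σ) volume volume := by
  have h := volume_measurePreserving_piCongrLeft (fun _ : Fin n => ℝ) σ.symm
  have he : (fun x : Fin n → ℝ => x ∘ σ) =
      MeasurableEquiv.piCongrLeft (fun _ : Fin n => ℝ) σ.symm := by
    funext x i
    have := Equiv.piCongrLeft_apply_apply (P := fun _ : Fin n => ℝ) σ.symm x (σ i)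
    simp only [Equiv.symm_apply_apply] at this
    exact this.symm
  rw [he]
  exact h

/-- A permutation-invariant function integrates over a cube to `n!` times its integral over the
increasing tuples. -/
theorem setLIntegral_eq_factorial_mul {n : ℕ} (L : ℝ) {g : (Fin n → ℝ) → ℝ≥0∞}
    (hg : Measurable g) (hsymm : ∀ (x : Fin n → ℝ) (σ : Equiv.Perm (Fin n)), g (x ∘ σ) = g x) :
    ∫⁻ x in Set.univ.pi fun _ => Set.Ico 0 L, g x =
      n ! * ∫⁻ x, (increasingTuples n L).indicator g x := by
  have hm : Measurable ((increasingTuples n L).indicator g) :=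
    hg.indicator (measurableSet_increasingTuples n L)
  rw [← lintegral_indicator (MeasurableSet.univ_pi fun _ => measurableSet_Ico)]
  -- Almost every tuple has distinct entries, so exactly one permutation makes it increasing.
  trans ∫⁻ x, ∑ σ : Equiv.Perm (Fin n), (increasingTuples n L).indicator g (x ∘ σ)
  · refine lintegral_congr_ae ?_
    filter_upwards [ae_injective_pi n] with x hx
    rw [Finset.sum_eq_single (Tuple.sort x)]
    · classical
      have hs : StrictMono (x ∘ Tuple.sort x) :=
        (Tuple.monotone_sort x).strictMono_of_injective (hx.comp (Tuple.sort x).injective)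
      have : x ∘ Tuple.sort x ∈ increasingTuples n L ↔
          x ∈ Set.univ.pi fun _ => Set.Ico 0 L := by
        refine ⟨fun h i _ => ?_, fun h => ⟨hs, fun i _ => h _ trivial⟩⟩
        have := h.2 ((Tuple.sort x).symm i) trivial
        simpa using this
      simp only [Set.indicator_apply, this, hsymm]
    · intro σ _ hσ
      exact Set.indicator_of_notMem (fun h => hσ (sort_eq_of_strictMono h.1).symm) _
    · simp
  · have h : ∀ σ : Equiv.Perm (Fin n), Measurable fun x : Fin n → ℝ =>
        (increasingTuples n L).indicator g (x ∘ σ) :=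
      fun σ => hm.comp (measurePreserving_comp_perm σ).measurable
    rw [lintegral_finsetSum _ fun σ _ => h σ]
    simp_rw [(measurePreserving_comp_perm _).lintegral_comp hm]
    simp [Fintype.card_perm]

/-! ### Rao's statistic: symmetry, measurability, total excess -/

theorem orderStat_comp_perm {n : ℕ} (x : Fin n → ℝ) (σ : Equiv.Perm (Fin n)) :
    orderStat (x ∘ σ) = orderStat x :=
  Tuple.comp_perm_comp_sort_eq_comp_sort

theorem raoSpacing_comp_perm {n : ℕ} (x : Fin n → ℝ) (σ : Equiv.Perm (Fin n)) :
    raoSpacing (x ∘ σ) = raoSpacing x := by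
  unfold raoSpacing spacing
  rw [orderStat_comp_perm]

theorem raoSpacing_nonneg {n : ℕ} (x : Fin n → ℝ) : 0 ≤ raoSpacing x := by
  unfold raoSpacing
  positivity

theorem measurableSet_eq_sort {n : ℕ} (σ : Equiv.Perm (Fin n)) :
    MeasurableSet {x : Fin n → ℝ | σ = Tuple.sort x} := by
  have h : {x : Fin n → ℝ | σ = Tuple.sort x} =
      (⋂ i, ⋂ j, ⋂ _ : i ≤ j, {x : Fin n → ℝ | x (σ i) ≤ x (σ j)}) ∩
      ⋂ i, ⋂ j, ⋂ _ : i < j, ⋂ _ : ¬ σ i < σ j, {x : Fin n → ℝ | x (σ i) = x (σ j)}ᶜ := by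
    ext x
    simp only [Set.mem_ofPred_eq, Tuple.eq_sort_iff, Monotone, Set.mem_inter_iff, Set.mem_iInter,
      Set.mem_compl_iff, Function.comp_apply]
    refine and_congr Iff.rfl (forall_congr' fun i => forall_congr' fun j =>
      forall_congr' fun _ => ?_)
    exact not_imp_not.symm
  rw [h]
  exact (MeasurableSet.iInter fun i => .iInter fun j => .iInter fun _ =>
      measurableSet_le (measurable_pi_apply (σ i)) (measurable_pi_apply (σ j))).inter
    (.iInter fun i => .iInter fun j => .iInter fun _ => .iInter fun _ =>
      (measurableSet_eq_fun (measurable_pi_apply (σ i)) (measurable_pi_apply (σ j))).compl)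

theorem measurable_orderStat {n : ℕ} (i : Fin n) :
    Measurable fun x : Fin n → ℝ => orderStat x i := by
  have h : (fun x : Fin n → ℝ => orderStat x i) = fun x => ∑ σ : Equiv.Perm (Fin n),
      {x : Fin n → ℝ | σ = Tuple.sort x}.indicator (fun x => x (σ i)) x := by
    funext x
    rw [Finset.sum_eq_single (Tuple.sort x)]
    · exact (Set.indicator_of_mem (s := {y | Tuple.sort x = Tuple.sort y}) rfl
        fun y : Fin n → ℝ => y (Tuple.sort x i)).symm
    · exact fun σ _ hσ => Set.indicator_of_notMem (s := {y | σ = Tuple.sort y}) hσ _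
    · exact fun h => absurd (Finset.mem_univ _) h
  rw [h]
  exact Finset.measurable_sum _ fun σ _ =>
    (measurable_pi_apply _).indicator (measurableSet_eq_sort σ)

theorem measurable_raoSpacing (n : ℕ) : Measurable (raoSpacing : (Fin n → ℝ) → ℝ) := by
  unfold raoSpacing
  have h : ∀ i : Fin n, Measurable fun x : Fin n → ℝ => spacing x i := fun i => by
    unfold spacing
    split_ifs
    · exact (measurable_orderStat _).sub (measurable_orderStat _)
    · exact ((measurable_orderStat _).sub (measurable_orderStat _)).add_const _
  have h2 : ∀ i : Fin n, Measurable fun x : Fin n → ℝ => |spacing x i - 2 * Real.pi / n| :=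
    fun i => by simpa using ((h i).sub_const (2 * Real.pi / n)).norm
  exact (Finset.measurable_sum _ fun i _ => h2 i).const_mul _

theorem abs_sub_eq_two_mul_excess (t c : ℝ) : |t - c| = 2 * excess c t - (t - c) := by
  unfold excess
  rcases le_total 0 (t - c) with h | h
  · rw [abs_of_nonneg h, max_eq_left h]; ring
  · rw [abs_of_nonpos h, max_eq_right h]; ring

/-- The deviations `t - c` sum to zero because `c` is the mean spacing, so only the excess term of
`abs_sub_eq_two_mul_excess` remains. -/
theorem raoSpacing_eq_circleExcess {m : ℕ} {x : Fin (m + 1) → ℝ} (hx : StrictMono x) :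
    raoSpacing x = circleExcess (2 * Real.pi / (m + 1 : ℕ)) (2 * Real.pi) x := by
  have hs : orderStat x = x := by
    unfold orderStat
    rw [sort_eq_of_strictMono (x := x) (σ := 1) hx]
    rfl
  have h1 : ∀ i : Fin m, spacing x i.castSucc = x i.succ - x i.castSucc := fun i => by
    simp only [spacing, hs]
    rw [dif_pos (by simp)]
    rfl
  have h2 : spacing x (Fin.last m) = x 0 - x (Fin.last m) + 2 * Real.pi := by
    simp only [spacing, hs]
    rw [dif_neg (by simp)]
    rfl
  have h3 : ∑ i : Fin m, (x i.succ - x i.castSucc) = x (Fin.last m) - x 0 := by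
    have e1 := Fin.sum_univ_succ x
    have e2 := Fin.sum_univ_castSucc x
    rw [Finset.sum_sub_distrib]
    linarith
  unfold raoSpacing circleExcess
  rw [Fin.sum_univ_castSucc]
  simp only [h1, h2, abs_sub_eq_two_mul_excess]
  generalize hc : 2 * Real.pi / ((m + 1 : ℕ) : ℝ) = c
  have h4 : (m + 1) * c = 2 * Real.pi := by
    rw [← hc]
    push_cast
    field_simp
  rw [Finset.sum_sub_distrib, ← Finset.mul_sum, Finset.sum_sub_distrib _ (fun _ => c), h3]
  simp only [Finset.sum_const, Finset.card_univ, Fintype.card_fin, nsmul_eq_mul]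
  linarith

/-! ### Joint law of the angles and the integral over the cube -/

theorem pi_cond_Ico (n : ℕ) {L : ℝ} (hL : 0 < L) :
    Measure.pi (fun _ : Fin n => ProbabilityTheory.cond volume (Set.Ico 0 L)) =
      (ENNReal.ofReal L)⁻¹ ^ n • volume.restrict (Set.univ.pi fun _ => Set.Ico 0 L) := by
  have hv : volume (Set.Ico 0 L) = ENNReal.ofReal L := by simp
  have : IsProbabilityMeasure (ProbabilityTheory.cond volume (Set.Ico 0 L)) :=
    cond_isProbabilityMeasure_of_finite (by simp [hL]) (by simp)
  refine Measure.pi_eq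
    (μ := fun _ : Fin n => ProbabilityTheory.cond volume (Set.Ico 0 L)) fun s hs => ?_
  rw [Measure.smul_apply, Measure.restrict_apply (MeasurableSet.univ_pi hs), Set.inter_comm,
    ← Set.pi_inter_distrib, volume_pi_pi]
  simp [cond_apply measurableSet_Ico, Finset.prod_mul_distrib]

/-- The joint law of independent uniform angles. -/
theorem map_eq_smul_restrict {Ω : Type*} [MeasurableSpace Ω] {P : Measure Ω}
    [IsProbabilityMeasure P] {n : ℕ} {α : Fin n → Ω → ℝ} {L : ℝ} (hL : 0 < L)
    (hα : ∀ i, AEMeasurable (α i) P) (hindep : iIndepFun α P)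
    (hunif : ∀ i, pdf.IsUniform (α i) (Set.Ico 0 L) P volume) :
    P.map (fun ω i => α i ω) =
      (ENNReal.ofReal L)⁻¹ ^ n • volume.restrict (Set.univ.pi fun _ => Set.Ico 0 L) := by
  rw [(iIndepFun_iff_map_fun_eq_pi_map hα).1 hindep, ← pi_cond_Ico n hL]
  congr 1
  exact funext fun i => hunif i

theorem measurable_dividedPow_raoSpacing (n r : ℕ) :
    Measurable fun x : Fin n → ℝ => dividedPow r (raoSpacing x) :=
  (measurable_dividedPow r).comp (measurable_raoSpacing n)

theorem mul_setLIntegral_raoSpacing (m r : ℕ) :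
    (m + 2 : ℕ) * ∫⁻ x : Fin (m + 2) → ℝ in Set.univ.pi fun _ => Set.Ico 0 (2 * Real.pi),
        dividedPow r (raoSpacing x) =
      (m + 2)! * (ENNReal.ofReal (2 * Real.pi) *
        excessIntegral (2 * Real.pi / (m + 2 : ℕ)) (m + 1) r (2 * Real.pi)) := by
  rw [setLIntegral_eq_factorial_mul _ (measurable_dividedPow_raoSpacing (m + 2) r)
    fun x σ => by rw [raoSpacing_comp_perm]]
  have h : (increasingTuples (m + 2) (2 * Real.pi)).indicator
        (fun x => dividedPow r (raoSpacing x)) =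
      (increasingTuples (m + 2) (2 * Real.pi)).indicator
        fun x => dividedPow r (circleExcess (2 * Real.pi / (m + 2 : ℕ)) (2 * Real.pi) x) :=
    Set.indicator_congr fun x hx => by rw [raoSpacing_eq_circleExcess hx.1]
  rw [h, lintegral_circleExcess, mul_left_comm, mul_lintegral_weighted_gapSum (by positivity)]

theorem excessIntegral_div (m r : ℕ) {L : ℝ} (hL : 0 ≤ L) :
    excessIntegral (L / (m + 2 : ℕ)) (m + 1) r L = ENNReal.ofReal
      (∑ j ∈ Finset.range (m + 3), ((m + 2).choose j * compNum r j : ℕ) *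
        ((L / (m + 2 : ℕ) * ((m + 2 : ℕ) - j)) ^ (m + 1 + r) / (m + 1 + r)!)) := by
  have hj : ∀ j ∈ Finset.range (m + 3), (0 : ℝ) ≤ L / (m + 2 : ℕ) * ((m + 2 : ℕ) - j) :=
    fun j hj => by
      have : (j : ℝ) ≤ (m + 2 : ℕ) := by
        exact_mod_cast Nat.lt_succ_iff.1 (Finset.mem_range.1 hj)
      exact mul_nonneg (by positivity) (sub_nonneg.2 this)
  rw [ENNReal.ofReal_sum_of_nonneg, excessIntegral]
  · refine Finset.sum_congr rfl fun j hj' => ?_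
    have he : L - j * (L / (m + 2 : ℕ)) = L / (m + 2 : ℕ) * ((m + 2 : ℕ) - j) := by
      field_simp
    rw [he, truncPow_of_nonneg (hj j hj'), ENNReal.ofReal_mul (by positivity),
      ENNReal.ofReal_natCast]
  · intro j hj'
    have := hj j hj'
    positivity

/-! ### The moment coefficients -/

theorem IsRaoCoeff.mul_factorial {a : ℕ → ℕ → ℤ} (ha : IsRaoCoeff a) {r j : ℕ} (hr : 1 ≤ r)
    (hj : 1 ≤ j) (hjr : j ≤ r) : a r j * j ! = r ! * compNum r j := by
  induction r, hr using Nat.le_induction generalizing j with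
  | base =>
    obtain rfl : j = 1 := by omega
    simp [ha.diag 1 le_rfl]
  | succ r hr ih =>
    rcases Nat.lt_or_ge r j with h | h
    · obtain rfl : j = r + 1 := by omega
      simp [ha.diag (r + 1) (by omega)]
    rcases hj.eq_or_lt with rfl | hj2
    · have := ih le_rfl hr
      obtain ⟨s, rfl⟩ := Nat.exists_eq_add_of_le' hr
      rw [ha.first _ hr, Nat.factorial_succ (s + 1)]
      simp only [compNum_succ_one, Nat.factorial_one, Nat.cast_one, mul_one] at this ⊢
      rw [this]
      push_cast
      ring
    · obtain ⟨k, rfl⟩ := Nat.exists_eq_add_of_le' (show 2 ≤ j from hj2)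
      obtain ⟨s, rfl⟩ := Nat.exists_eq_add_of_le' hr
      have h1 := ih (j := k + 2) (by omega) h
      have h2 := ih (j := k + 1) (by omega) (by omega)
      -- This ratio of adjacent binomials is what the recursion needs beyond Pascal's rule.
      have h3 : (s.choose (k + 1) : ℤ) * (k + 1) = s.choose k * (s - k) := by
        have := Nat.choose_succ_right_eq s k
        rw [← Nat.cast_sub (by omega : k ≤ s)]
        exact_mod_cast this
      rw [ha.step _ _ hj2 h, Nat.factorial_succ (s + 1)]
      rw [Nat.factorial_succ (k + 1)] at h1 ⊢
      simp only [compNum_succ_succ, show k + 2 - 1 = k + 1 by omega] at h1 h2 ⊢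
      rw [Nat.choose_succ_succ s k]
      push_cast at h1 h2 ⊢
      linear_combination (s + 1 + (k + 2) : ℤ) * h1 + (k + 2 : ℤ) * h2 + ((s + 1)! : ℤ) * h3

/-- The (unsigned) Lah numbers, on the range `1 ≤ j ≤ r`. -/
def lahNum : ℕ → ℕ → ℤ
  | 0, _ => 0
  | r + 1, j =>
    if j = r + 1 then 1 else (r + j) * lahNum r j + if j = 1 then 0 else lahNum r (j - 1)

theorem isRaoCoeff_lahNum : IsRaoCoeff lahNum where
  diag r hr := by
    obtain ⟨s, rfl⟩ := Nat.exists_eq_add_of_le' hr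
    simp [lahNum]
  first r hr := by
    rw [lahNum, if_neg (by omega)]
    simp
  step r j hj hjr := by
    rw [lahNum, if_neg (by omega), if_neg (by omega)]

/-- Both sums extend to a common range: `n.choose j` vanishes for `j > n`, and `compNum r j` for `j
= 0` or `j > r`. Hence `r > n` needs no separate treatment. -/
theorem IsRaoCoeff.sum_eq {a : ℕ → ℕ → ℤ} (ha : IsRaoCoeff a) {r : ℕ} (hr : 1 ≤ r) (n : ℕ)
    (f : ℕ → ℝ) :
    ∑ j ∈ Finset.Icc 1 r, (a r j : ℝ) * (n.descFactorial j : ℝ) * f j =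
      r ! * ∑ j ∈ Finset.range (n + 1), ((n.choose j * compNum r j : ℕ) : ℝ) * f j := by
  have h1 : ∑ j ∈ Finset.range (n + 1), ((n.choose j * compNum r j : ℕ) : ℝ) * f j =
      ∑ j ∈ Finset.range (n + r + 1), ((n.choose j * compNum r j : ℕ) : ℝ) * f j := by
    refine Finset.sum_subset (Finset.range_subset_range.2 (by omega)) fun j _ hj => ?_
    rw [Nat.choose_eq_zero_of_lt (by simpa using hj)]
    simp
  have h2 : ∑ j ∈ Finset.Icc 1 r, ((n.choose j * compNum r j : ℕ) : ℝ) * f j =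
      ∑ j ∈ Finset.range (n + r + 1), ((n.choose j * compNum r j : ℕ) : ℝ) * f j := by
    refine Finset.sum_subset (fun j hj => ?_) fun j _ hj => ?_
    · rw [Finset.mem_Icc] at hj
      exact Finset.mem_range.2 (by omega)
    · obtain ⟨s, rfl⟩ := Nat.exists_eq_add_of_le' hr
      cases j with
      | zero => simp
      | succ j =>
        rw [compNum_succ_succ, Nat.choose_eq_zero_of_lt (n := s)]
        · simp
        · simp only [Finset.mem_Icc] at hj
          omega
  rw [h1, ← h2, Finset.mul_sum]
  refine Finset.sum_congr rfl fun j hj => ?_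
  rw [Finset.mem_Icc] at hj
  have h : (a r j : ℝ) * j ! = r ! * compNum r j := by
    exact_mod_cast ha.mul_factorial hr hj.1 hj.2
  rw [Nat.descFactorial_eq_factorial_mul_choose]
  push_cast
  linear_combination (n.choose j * f j : ℝ) * h

/-! ### The moments -/

theorem raoSpacing_moment {Ω : Type*} [MeasurableSpace Ω] {P : Measure Ω}
    [IsProbabilityMeasure P] {n : ℕ} (hn : 2 ≤ n) {α : Fin n → Ω → ℝ} (hindep : iIndepFun α P)
    (hunif : ∀ i, pdf.IsUniform (α i) (Set.Ico 0 (2 * Real.pi)) P volume)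
    {a : ℕ → ℕ → ℤ} (ha : IsRaoCoeff a) {r : ℕ} (hr : 1 ≤ r) :
    Integrable (fun ω => raoSpacing (fun i => α i ω) ^ r) P ∧
      ∫ ω, raoSpacing (fun i => α i ω) ^ r ∂P =
        (2 * Real.pi) ^ r / ((n : ℝ) ^ (n + r - 1) * (n.ascFactorial r : ℝ)) *
          ∑ j ∈ Finset.Icc 1 r,
            (a r j : ℝ) * (n.descFactorial j : ℝ) * ((n : ℝ) - (j : ℝ)) ^ (n + r - 1) := by
  obtain ⟨m, rfl⟩ := Nat.exists_eq_add_of_le' hn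
  have hL : 0 < 2 * Real.pi := by positivity
  -- A uniform law on a set of finite nonzero measure is a nonzero measure, which forces a.e.
  -- measurability.
  have hα : ∀ i, AEMeasurable (α i) P := fun i =>
    (hunif i).aemeasurable (by simp [Real.pi_pos])
      (by simpa using ENNReal.mul_ne_top (by simp) ENNReal.ofReal_ne_top)
  have hαm : AEMeasurable (fun ω i => α i ω) P := aemeasurable_pi_iff.2 hα
  set S : ℝ := ∑ j ∈ Finset.range (m + 3), ((m + 2).choose j * compNum r j : ℕ) *
    ((2 * Real.pi / (m + 2 : ℕ) * ((m + 2 : ℕ) - j)) ^ (m + 1 + r) / (m + 1 + r)!) with hS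
  have hI : (m + 2 : ℕ) * ∫⁻ ω, dividedPow r (raoSpacing fun i => α i ω) ∂P =
      (ENNReal.ofReal (2 * Real.pi))⁻¹ ^ (m + 2) *
        ((m + 2)! * (ENNReal.ofReal (2 * Real.pi) * ENNReal.ofReal S)) := by
    rw [← lintegral_map' (measurable_dividedPow_raoSpacing (m + 2) r).aemeasurable hαm,
      map_eq_smul_restrict hL hα hindep hunif, lintegral_smul_measure, smul_eq_mul,
      mul_left_comm, mul_setLIntegral_raoSpacing, excessIntegral_div m r hL.le]
  -- Finiteness of the moment is read off from the formula, whose right side is finite.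
  have hfin : ∫⁻ ω, dividedPow r (raoSpacing fun i => α i ω) ∂P ≠ ∞ := fun h => by
    rw [h, ENNReal.mul_top (by simp)] at hI
    refine (ENNReal.mul_ne_top (ENNReal.pow_ne_top ?_) ?_) hI.symm
    · simpa using Real.pi_pos
    · exact ENNReal.mul_ne_top (by simp) (ENNReal.mul_ne_top
        ENNReal.ofReal_ne_top ENNReal.ofReal_ne_top)
  have hmeas : AEStronglyMeasurable (fun ω => raoSpacing (fun i => α i ω) ^ r / r !) P :=
    ((((measurable_raoSpacing _).pow_const r).div_const _).comp_aemeasurable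
      hαm).aestronglyMeasurable
  have hnonneg : ∀ ω, 0 ≤ raoSpacing (fun i => α i ω) ^ r / r ! := fun ω =>
    div_nonneg (pow_nonneg (raoSpacing_nonneg _) r) (by positivity)
  have hint : Integrable (fun ω => raoSpacing (fun i => α i ω) ^ r / r !) P := by
    refine ⟨hmeas, ?_⟩
    rw [hasFiniteIntegral_iff_ofReal (.of_forall hnonneg)]
    exact hfin.lt_top
  have hval : (m + 2 : ℕ) * ∫ ω, raoSpacing (fun i => α i ω) ^ r / (r ! : ℝ) ∂P =
      (2 * Real.pi)⁻¹ ^ (m + 2) * ((m + 2)! * (2 * Real.pi * S)) := by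
    rw [integral_eq_lintegral_of_nonneg_ae (.of_forall hnonneg) hmeas]
    have hS0 : 0 ≤ S := Finset.sum_nonneg fun j hj => by
      have : (j : ℝ) ≤ (m + 2 : ℕ) := by
        exact_mod_cast Nat.lt_succ_iff.1 (Finset.mem_range.1 hj)
      have := sub_nonneg.2 this
      positivity
    have := congrArg ENNReal.toReal hI
    simpa only [dividedPow, ENNReal.toReal_mul, ENNReal.toReal_pow, ENNReal.toReal_inv,
      ENNReal.toReal_natCast, ENNReal.toReal_ofReal hL.le, ENNReal.toReal_ofReal hS0] using this
  have hr0 : (r ! : ℝ) ≠ 0 := by positivity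
  refine ⟨by simpa [div_mul_cancel₀ _ hr0] using hint.mul_const (r ! : ℝ), ?_⟩
  rw [integral_div] at hval
  rw [ha.sum_eq hr (m + 2) fun j => (((m + 2 : ℕ) : ℝ) - j) ^ (m + 2 + r - 1)]
  have hasc : ((m + 1)! : ℝ) * ((m + 2).ascFactorial r : ℝ) = (m + 1 + r)! := by
    exact_mod_cast Nat.factorial_mul_ascFactorial (m + 1) r
  have hS2 : S = (2 * Real.pi / (m + 2 : ℕ)) ^ (m + 1 + r) / (m + 1 + r)! *
      ∑ j ∈ Finset.range (m + 2 + 1), (((m + 2).choose j * compNum r j : ℕ) : ℝ) *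
        (((m + 2 : ℕ) : ℝ) - j) ^ (m + 2 + r - 1) := by
    rw [hS, Finset.mul_sum]
    refine Finset.sum_congr rfl fun j _ => ?_
    rw [mul_pow, show m + 2 + r - 1 = m + 1 + r by omega]
    ring
  rw [hS2, ← hasc] at hval
  generalize ∑ j ∈ Finset.range (m + 2 + 1), (((m + 2).choose j * compNum r j : ℕ) : ℝ) *
    (((m + 2 : ℕ) : ℝ) - j) ^ (m + 2 + r - 1) = T at hval ⊢
  generalize ∫ ω, raoSpacing (fun i => α i ω) ^ r ∂P = E at hval ⊢
  have hasc0 : ((m + 2).ascFactorial r : ℝ) ≠ 0 := by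
    exact_mod_cast (Nat.ascFactorial_pos (m + 1) r).ne'
  have hn0 : ((m + 2 : ℕ) : ℝ) ≠ 0 := by positivity
  have hm0 : ((m + 1)! : ℝ) ≠ 0 := by positivity
  have hfac : ((m + 2)! : ℝ) = (m + 2 : ℕ) * (m + 1)! := by
    exact_mod_cast Nat.factorial_succ (m + 1)
  rw [show m + 2 + r - 1 = m + 1 + r by omega]
  rw [hfac] at hval
  have hval2 : E = r ! * ((2 * Real.pi)⁻¹ ^ (m + 2) * ((m + 1)! * (2 * Real.pi *
      ((2 * Real.pi / (m + 2 : ℕ)) ^ (m + 1 + r) / ((m + 1)! * (m + 2).ascFactorial r) * T)))) := by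
    have : ((m + 2 : ℕ) : ℝ) * (E / r !) = (m + 2 : ℕ) * ((2 * Real.pi)⁻¹ ^ (m + 2) *
      ((m + 1)! * (2 * Real.pi * ((2 * Real.pi / (m + 2 : ℕ)) ^ (m + 1 + r) /
        ((m + 1)! * (m + 2).ascFactorial r) * T)))) := by
      rw [hval]
      ring
    have := mul_left_cancel₀ hn0 this
    rw [← this]
    field_simp
  rw [hval2, div_pow, inv_pow]
  have hLne : 2 * Real.pi ≠ 0 := hL.ne'
  generalize 2 * Real.pi = L at hLne ⊢
  field_simp
  ring

theorem theorem1 {Ω : Type*} [MeasurableSpace Ω] (P : Measure Ω) [IsProbabilityMeasure P]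
    (n : ℕ) (hn : 2 ≤ n) (α : Fin n → Ω → ℝ)
    (hindep : iIndepFun α P)
    (hunif : ∀ i, pdf.IsUniform (α i) (Set.Ico 0 (2 * Real.pi)) P volume) :
    (∃ a : ℕ → ℕ → ℤ, IsRaoCoeff a) ∧
    (∀ a : ℕ → ℕ → ℤ, IsRaoCoeff a → ∀ r : ℕ, 1 ≤ r →
      Integrable (fun ω => raoSpacing (fun i => α i ω) ^ r) P ∧
      ∫ ω, raoSpacing (fun i => α i ω) ^ r ∂P =
        (2 * Real.pi) ^ r / ((n : ℝ) ^ (n + r - 1) * (n.ascFactorial r : ℝ)) *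
          ∑ j ∈ Finset.Icc 1 r,
            (a r j : ℝ) * (n.descFactorial j : ℝ) * ((n : ℝ) - (j : ℝ)) ^ (n + r - 1)) ∧
    ∫ ω, raoSpacing (fun i => α i ω) ∂P = 2 * Real.pi * (1 - 1 / (n : ℝ)) ^ n := by
  refine ⟨⟨lahNum, isRaoCoeff_lahNum⟩,
    fun a ha r hr => raoSpacing_moment hn hindep hunif ha hr, ?_⟩
  have h := (raoSpacing_moment hn hindep hunif isRaoCoeff_lahNum (le_refl 1)).2
  simp only [pow_one] at h
  have hn0 : (n : ℝ) ≠ 0 := by positivity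
  rw [h, one_sub_div hn0, div_pow]
  simp [isRaoCoeff_lahNum.diag 1 le_rfl, Nat.ascFactorial]
  field_simp
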